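/- Let $M$ be a connected $C^\infty$ manifold without boundary, endowed with a complete Riemannian metric; $\|\cdot\|$ denotes the norm on each $T_xM$ and also the dual norm on each $T^*_xM$. Let $H:T^*M\to\mathbb{R}$ be a function of class $C^2$ such that: (1) for every $K\ge 0$ there is $C^*(K)\in\mathbb{R}$ with $H(x,p)\ge K\|p\|-C^*(K)$ for all $(x,p)\in T^*M$; (2) for every $R\ge 0$, $\sup\{H(x,p) : (x,p)\in T^*M,\ \|p\|\le R\}<+\infty$; (3) for every $(x,p)\in T^*M$, the second derivative along the fiber $\frac{\partial^2H}{\partial p^2}(x,p)$ is positive definite. Let $L:TM\to\mathbb{R}$ be the associated Lagrangian, $L(x,v)=\sup_{p\in T^*_xM}\big(p(v)-H(x,p)\big)$. Let $U\subset M$ be open, let $c\in\mathbb{R}$, and let $u:U\to\mathbb{R}$ be continuous. Then the following are equivalent: (a) $u$ is a viscosity subsolution of $H(x,d_xu)=c$ on $U$: for every $C^1$ function $\phi:U\to\mathbb{R}$ and every $x_0\in U$ at which $u-\phi$ attains its maximum over $U$, one has $H(x_0,d_{x_0}\phi)\le c$; (b) $u$ is dominated by $L+c$ on $U$: for all real $a\le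 b$ and every piecewise $C^1$ curve $\gamma:[a,b]\to U$, $$u(\gamma(b))-u(\gamma(a))\le\int_a^b L(\gamma(s),\dot\gamma(s))\,ds+c\,(b-a).$$ -/

import Mathlib

open Set MeasureTheory Bundle
open scoped Manifold ContDiff Topology

noncomputable section

/-- The total space of the cotangent bundle of a manifold `M` modelled on `E`: its points are
pairs `⟨x, p⟩` with `p` a linear form on the tangent space of `M` at `x`. It carries Mathlib's
topology and manifold structure of a bundle of continuous linear maps. -/
abbrev CotangentBundle (E : Type*) [NormedAddCommGroup E] [NormedSpace ℝ E]
    (M : Type*) [TopologicalSpace M] [ChartedSpace E M] : Type _ :=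
  TotalSpace (E →L[ℝ] ℝ) (fun x : M ↦ TangentSpace 𝓘(ℝ, E) x →L[ℝ] ℝ)

section Hamiltonian

variable {E : Type*} [NormedAddCommGroup E] [NormedSpace ℝ E]
  {M : Type*} [TopologicalSpace M] [ChartedSpace E M] [IsManifold 𝓘(ℝ, E) ∞ M]
  [RiemannianBundle (fun x : M ↦ TangentSpace 𝓘(ℝ, E) x)]

/-- The standing assumptions on a Hamiltonian `H : T*M → ℝ`. The norm of a covector is the
dual norm of the Riemannian norm on the tangent space. -/
structure IsTonelliHamiltonian (H : CotangentBundle E M → ℝ) : Prop where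
  /-- `H` is of class `C^2` on the cotangent bundle. -/
  contMDiff : ContMDiff (𝓘(ℝ, E).prod 𝓘(ℝ, E →L[ℝ] ℝ)) 𝓘(ℝ, ℝ) 2 H
  /-- Uniform superlinearity. -/
  superlinear : ∀ K : ℝ, 0 ≤ K → ∃ C : ℝ, ∀ (x : M) (p : TangentSpace 𝓘(ℝ, E) x →L[ℝ] ℝ),
    K * ‖p‖ - C ≤ H ⟨x, p⟩
  /-- Uniform boundedness on the balls of the fibers. -/
  bounded : ∀ R : ℝ, 0 ≤ R → ∃ A : ℝ, ∀ (x : M) (p : TangentSpace 𝓘(ℝ, E) x →L[ℝ] ℝ),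
    ‖p‖ ≤ R → H ⟨x, p⟩ ≤ A
  /-- The second derivative along the fibers is positive definite. -/
  strictConvex : ∀ (x : M) (p q : TangentSpace 𝓘(ℝ, E) x →L[ℝ] ℝ), q ≠ 0 →
    0 < iteratedFDeriv ℝ 2 (fun p' : TangentSpace 𝓘(ℝ, E) x →L[ℝ] ℝ ↦ H ⟨x, p'⟩) p ![q, q]

end Hamiltonian

section Notions

variable {E : Type*} [NormedAddCommGroup E] [NormedSpace ℝ E]
  {M : Type*} [TopologicalSpace M] [ChartedSpace E M]

/-- The Lagrangian associated with `H`: `L(x, v) = sup_p (p(v) - H(x, p))`. For a uniformly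
superlinear `H` the supremum is over a nonempty set that is bounded above. -/
def lagrangian (H : CotangentBundle E M → ℝ) (x : M) (v : TangentSpace 𝓘(ℝ, E) x) : ℝ :=
  ⨆ p : TangentSpace 𝓘(ℝ, E) x →L[ℝ] ℝ, (p v - H ⟨x, p⟩)

/-- `γ` is a piecewise `C^1` curve on `[a, b]`, `a ≤ b`: there is a finite subdivision
`a = t 0 < ⋯ < t n = b` such that `γ` is `C^1` on every closed interval `[t i, t (i + 1)]`.
(`n = 0` is the constant curve on `[a, a]`.) -/
def IsPiecewiseC1 (γ : ℝ → M) (a b : ℝ) : Prop :=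
  ∃ (n : ℕ) (t : ℕ → ℝ), t 0 = a ∧ t n = b ∧
    ∀ i < n, t i < t (i + 1) ∧ ContMDiffOn 𝓘(ℝ, ℝ) 𝓘(ℝ, E) 1 γ (Icc (t i) (t (i + 1)))

/-- The velocity of a curve. -/
def velocity (γ : ℝ → M) (s : ℝ) : TangentSpace 𝓘(ℝ, E) (γ s) :=
  mfderiv 𝓘(ℝ, ℝ) 𝓘(ℝ, E) γ s (1 : ℝ)

/-- `u` is dominated by `L + c` on `U`, where `L` is the Lagrangian of `H`. Only the values of
`u` on `U` matter. The velocity exists at all but finitely many times. -/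
def IsDominatedOn (H : CotangentBundle E M → ℝ) (c : ℝ) (U : Set M) (u : M → ℝ) : Prop :=
  ∀ (γ : ℝ → M) (a b : ℝ), a ≤ b → IsPiecewiseC1 (E := E) γ a b → (∀ s ∈ Icc a b, γ s ∈ U) →
    u (γ b) - u (γ a) ≤
      (∫ s in a..b, lagrangian H (γ s) (velocity (E := E) γ s)) + c * (b - a)

/-- `u` is a viscosity subsolution of `F(x, d_x u) = c` on the open set `U`: whenever `φ` is a
`C^1` function on `U` and `u - φ` has a maximum over `U` at `x₀ ∈ U`, the inequality
`F(x₀, d_{x₀} φ) ≤ c` holds. Only the values of `u` and `φ` on `U` matter. -/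
def IsViscositySubsolutionOn (F : CotangentBundle E M → ℝ) (c : ℝ) (U : Set M)
    (u : M → ℝ) : Prop :=
  ∀ φ : M → ℝ, ContMDiffOn 𝓘(ℝ, E) 𝓘(ℝ, ℝ) 1 φ U →
    ∀ x₀ ∈ U, IsMaxOn (fun x ↦ u x - φ x) U x₀ →
      F ⟨x₀, mfderiv 𝓘(ℝ, E) 𝓘(ℝ, ℝ) φ x₀⟩ ≤ c

end Notions

end

/-!
For a Hamiltonian `H` that is superlinear and convex along the fibers, viscosity subsolutions of
`H(x, d_x u) = c` are the functions dominated by `L + c`. Only continuity of `u` is used; no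
Lipschitz estimate and no almost everywhere differentiability enters.

*Subsolutions are dominated* (`IsViscositySubsolutionOn.sub_le_integral`). Along a `C^1` curve `γ`
on `[a, b]` that violates the inequality, `t ↦ u (γ t) - ψ t` with
`ψ t = ∫_a^t L(γ, γ') + (c + δ) (t - a)` and a small `δ > 0` has its maximum over `[a, b]` at
some `t₀ > a`. It then suffices that `ψ' t₀ ≤ L(γ t₀, γ' t₀) + c`, which is
`IsViscositySubsolutionOn.deriv_le_lagrangian`, proved by doubling the variables: in a chart `χ`
at `γ t₀`, the function `u x - ψ t - n |χ x - χ (γ t)|²` is maximized over a compact set of pairs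
`(x, t)`. At a maximum point the penalty is a test function for `u` in the variable `x`, with
differential `q`, so that `H(x, q) ≤ c`; in the variable `t` the maximum gives
`ψ' t ≤ q((χ ∘ γ)' t)`; the Fenchel inequality `q(w) ≤ L(x, w) + H(x, q)` combines the two. As
`n → ∞` the maximum points converge to `(γ t₀, t₀)`, and the inequality passes to the limit since
`L` is continuous (`IsTonelliHamiltonian.continuousAt_lagrangian_ofChart`). The penalty lives in a
chart only; `IsViscositySubsolutionOn.le_of_isLocalMax` extends it to a test function on `U` by a
partition of unity, which exists because a connected manifold with a metric is `σ`-compact.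

*Dominated functions are subsolutions* (`IsDominatedOn.isViscositySubsolutionOn`). If `u - φ` is
maximal at `x₀`, domination along a curve that arrives at `x₀` with velocity `v` gives
`d_{x₀}φ(v) ≤ L(x₀, v) + c`. For the vector `v` dual to `d_{x₀}φ`, that is the fiber derivative
of `H` there, convexity of `H` makes the Fenchel inequality an equality
(`IsTonelliHamiltonian.exists_lagrangian_add_le`), and `H(x₀, d_{x₀}φ) ≤ c` follows.
-/

open Filter

/-! ### Topological preliminaries -/

/-- Starting from a point and repeatedly adding the finitely many compact members of a locally
finite cover that meet the set reached so far, one exhausts a clopen set. -/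
theorem sigmaCompactSpace_of_connected_paracompact (X : Type*) [TopologicalSpace X]
    [ConnectedSpace X] [ParacompactSpace X] [WeaklyLocallyCompactSpace X] :
    SigmaCompactSpace X := by
  choose K hK hKx using fun x : X ↦ exists_compact_mem_nhds x
  obtain ⟨V, hVo, hVc, hVf, hVK⟩ := precise_refinement (fun x ↦ interior (K x))
    (fun x ↦ isOpen_interior)
    (iUnion_eq_univ_iff.2 fun x ↦ ⟨x, mem_interior_iff_mem_nhds.2 (hKx x)⟩)
  let next : Set X → Set X := fun S ↦ ⋃ i ∈ {i | (V i ∩ S).Nonempty}, K i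
  have next_compact : ∀ S, IsCompact S → IsCompact (next S) := fun S hS ↦
    (hVf.finite_nonempty_inter_compact hS).isCompact_biUnion fun i _ ↦ hK i
  have sub_next : ∀ S i, (V i ∩ S).Nonempty → V i ⊆ next S := fun S i hi x hx ↦
    mem_biUnion (show i ∈ {i | (V i ∩ S).Nonempty} from hi) (interior_subset (hVK i hx))
  obtain ⟨x₀⟩ := (inferInstance : Nonempty X)
  let C : ℕ → Set X := fun n ↦ next^[n] {x₀}
  have C_succ : ∀ n, C (n + 1) = next (C n) := fun n ↦ Function.iterate_succ_apply' next n {x₀}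
  have C_compact : ∀ n, IsCompact (C n) := by
    intro n
    induction n with
    | zero => exact isCompact_singleton
    | succ n ih => rw [C_succ]; exact next_compact _ ih
  have exists_V : ∀ x, ∃ i, x ∈ V i := fun x ↦ iUnion_eq_univ_iff.1 hVc x
  have hclopen : IsClopen (⋃ n, C n) := by
    constructor
    · refine isClosed_of_closure_subset fun x hx ↦ ?_
      obtain ⟨i, hi⟩ := exists_V x
      obtain ⟨y, hyV, hyC⟩ := mem_closure_iff.1 hx (V i) (hVo i) hi
      obtain ⟨n, hn⟩ := mem_iUnion.1 hyC
      exact mem_iUnion.2 ⟨n + 1, C_succ n ▸ sub_next _ i ⟨y, hyV, hn⟩ hi⟩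
    · refine isOpen_iff_mem_nhds.2 fun x hx ↦ ?_
      obtain ⟨n, hn⟩ := mem_iUnion.1 hx
      obtain ⟨i, hi⟩ := exists_V x
      refine mem_of_superset ((hVo i).mem_nhds hi) fun y hy ↦ ?_
      exact mem_iUnion.2 ⟨n + 1, C_succ n ▸ sub_next _ i ⟨x, hi, hn⟩ hy⟩
  exact ⟨C, C_compact, hclopen.eq_univ ⟨x₀, mem_iUnion.2 ⟨0, rfl⟩⟩⟩

/-- A pointwise supremum is continuous at `x₀` if near `x₀` the parameters outside a fixed compact
set do not contribute to it. -/
theorem continuousAt_iSup_of_compact {X Q : Type*} [TopologicalSpace X] [TopologicalSpace Q]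
    {f : X → Q → ℝ} {x₀ : X} {K : Set Q} (hK : IsCompact K) {q₀ : Q} (hq₀ : q₀ ∈ K)
    (hf : ∀ q ∈ K, ContinuousAt (fun z : X × Q ↦ f z.1 z.2) (x₀, q))
    (hbdd : ∀ᶠ x in 𝓝 x₀, BddAbove (range (f x)))
    (hout : ∀ᶠ x in 𝓝 x₀, ∀ q ∉ K, f x q ≤ f x q₀) :
    ContinuousAt (fun x ↦ ⨆ q, f x q) x₀ := by
  have : Nonempty Q := ⟨q₀⟩
  rw [Metric.continuousAt_iff']
  intro ε hε
  have hε2 : 0 < ε / 2 := half_pos hε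
  have hclose : ∀ᶠ x in 𝓝 x₀, ∀ q ∈ K, |f x q - f x₀ q| < ε / 2 := by
    refine hK.eventually_forall_of_forall_eventually
      (P := fun x q ↦ |f x q - f x₀ q| < ε / 2) fun q hq ↦ ?_
    have h₂ : ContinuousAt (fun z : X × Q ↦ f x₀ z.2) (x₀, q) :=
      (hf q hq).comp' (f := fun z : X × Q ↦ (x₀, z.2)) (x := (x₀, q)) (by fun_prop)
    have h := ((hf q hq).sub h₂).abs
    have h0 : |f (x₀, q).1 (x₀, q).2 - f x₀ (x₀, q).2| < ε / 2 := by simpa using hε2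
    exact h.eventually_lt continuousAt_const h0
  filter_upwards [hclose, hout, hbdd] with x hx hxo hbx
  have hbx₀ := hbdd.self_of_nhds
  have hxo₀ := hout.self_of_nhds
  have hq : ∀ q, f x q ≤ (⨆ q, f x₀ q) + ε / 2 := by
    intro q
    by_cases hqK : q ∈ K
    · linarith [le_ciSup hbx₀ q, (abs_lt.1 (hx q hqK)).2]
    · linarith [hxo q hqK, le_ciSup hbx₀ q₀, (abs_lt.1 (hx q₀ hq₀)).2]
  have hq' : ∀ q, f x₀ q ≤ (⨆ q, f x q) + ε / 2 := by
    intro q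
    by_cases hqK : q ∈ K
    · linarith [le_ciSup hbx q, (abs_lt.1 (hx q hqK)).1]
    · linarith [hxo₀ q hqK, le_ciSup hbx q₀, (abs_lt.1 (hx q₀ hq₀)).1]
  have h1 := ciSup_le hq
  have h2 := ciSup_le hq'
  rw [Real.dist_eq, abs_lt]
  constructor <;> linarith

/-! ### The Lagrangian in a chart -/

section
variable {E : Type*} [NormedAddCommGroup E] [NormedSpace ℝ E]
  {M : Type*} [TopologicalSpace M] [ChartedSpace E M] [IsManifold 𝓘(ℝ, E) ∞ M]

/-- The coordinates of a tangent vector at `y` in the chart at `x₀`, as given by the trivialization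
of the tangent bundle at `x₀`. For `y` in the chart domain this is the derivative of the chart. -/
noncomputable abbrev toChart (x₀ y : M) : TangentSpace 𝓘(ℝ, E) y →L[ℝ] E :=
  (trivializationAt E (TangentSpace 𝓘(ℝ, E)) x₀).continuousLinearMapAt ℝ y

/-- The tangent vector at `y` with given coordinates in the chart at `x₀`; the inverse of
`toChart x₀ y` for `y` in the chart domain. -/
noncomputable abbrev ofChart (x₀ y : M) : E →L[ℝ] TangentSpace 𝓘(ℝ, E) y :=
  (trivializationAt E (TangentSpace 𝓘(ℝ, E)) x₀).symmL ℝ y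

theorem toChart_ofChart {x₀ y : M} (hy : y ∈ (chartAt E x₀).source) (w : E) :
    toChart x₀ y (ofChart x₀ y w) = w :=
  Trivialization.continuousLinearMapAt_symmL _ (by simpa using hy) w

theorem ofChart_toChart {x₀ y : M} (hy : y ∈ (chartAt E x₀).source)
    (v : TangentSpace 𝓘(ℝ, E) y) : ofChart x₀ y (toChart x₀ y v) = v :=
  Trivialization.symmL_continuousLinearMapAt _ (by simpa using hy) v

/-- The covector at `y` whose coordinates in the chart at `x₀` are `q` depends continuously on
`(y, q)`. -/
theorem continuousAt_mk_comp_toChart (x₀ : M) (q₀ : E →L[ℝ] ℝ) :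
    ContinuousAt (fun z : M × (E →L[ℝ] ℝ) ↦
      (⟨z.1, z.2 ∘L toChart x₀ z.1⟩ : CotangentBundle E M)) (x₀, q₀) := by
  refine (continuousAt_hom_bundle (σ := RingHom.id ℝ) (E₁ := fun x : M ↦ TangentSpace 𝓘(ℝ, E) x)
    (E₂ := fun _ : M ↦ ℝ) _).2 ⟨continuousAt_fst, ?_⟩
  refine continuousAt_snd.congr_of_eventuallyEq ?_
  have h : ∀ᶠ z : M × (E →L[ℝ] ℝ) in 𝓝 (x₀, q₀), z.1 ∈ (chartAt E x₀).source :=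
    continuousAt_fst.eventually ((chartAt E x₀).open_source.mem_nhds (mem_chart_source E x₀))
  filter_upwards [h] with z hz
  ext w
  simp only [ContinuousLinearMap.inCoordinates, ContinuousLinearMap.comp_apply]
  rw [toChart_ofChart hz]
  simp

theorem lagrangian_ofChart (H : CotangentBundle E M → ℝ) {x₀ y : M}
    (hy : y ∈ (chartAt E x₀).source) (w : E) :
    lagrangian H y (ofChart x₀ y w) =
      ⨆ q : E →L[ℝ] ℝ, (q w - H ⟨y, q ∘L toChart x₀ y⟩) := by
  symm
  refine Function.Surjective.iSup_congr
    (fun q : E →L[ℝ] ℝ ↦ (q ∘L toChart x₀ y : TangentSpace 𝓘(ℝ, E) y →L[ℝ] ℝ)) (fun p ↦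
      ⟨p ∘L ofChart x₀ y, ?_⟩) fun q ↦ ?_
  · ext v
    simp only [ContinuousLinearMap.comp_apply]
    rw [ofChart_toChart hy]
  · simp only [ContinuousLinearMap.comp_apply]
    rw [toChart_ofChart hy]

end

section
variable {E : Type*} [NormedAddCommGroup E] [NormedSpace ℝ E]
  {M : Type*} [TopologicalSpace M] [ChartedSpace E M] [IsManifold 𝓘(ℝ, E) ∞ M]
  [RiemannianBundle (fun x : M ↦ TangentSpace 𝓘(ℝ, E) x)]
  {H : CotangentBundle E M → ℝ}

theorem IsTonelliHamiltonian.bddAbove (hH : IsTonelliHamiltonian H) (x : M)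
    (v : TangentSpace 𝓘(ℝ, E) x) :
    BddAbove (range fun p : TangentSpace 𝓘(ℝ, E) x →L[ℝ] ℝ ↦ p v - H ⟨x, p⟩) := by
  obtain ⟨C, hC⟩ := hH.superlinear ‖v‖ (norm_nonneg v)
  refine ⟨C, ?_⟩
  rintro _ ⟨p, rfl⟩
  have h1 : p v ≤ ‖p‖ * ‖v‖ := (le_abs_self _).trans (p.le_opNorm v)
  have h2 := hC x p
  dsimp only
  linarith [mul_comm ‖p‖ ‖v‖]

/-- The Fenchel inequality. -/
theorem IsTonelliHamiltonian.le_lagrangian_add (hH : IsTonelliHamiltonian H) (x : M)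
    (p : TangentSpace 𝓘(ℝ, E) x →L[ℝ] ℝ) (v : TangentSpace 𝓘(ℝ, E) x) :
    p v ≤ lagrangian H x v + H ⟨x, p⟩ := by
  have h : p v - H ⟨x, p⟩ ≤ lagrangian H x v := le_ciSup (hH.bddAbove x v) p
  linarith

/-- The Lagrangian, written in the chart at `x₀`, is jointly continuous above `x₀`. By
superlinearity only covectors in a fixed ball contribute to the supremum near a given vector. -/
theorem IsTonelliHamiltonian.continuousAt_lagrangian_ofChart [FiniteDimensional ℝ E]
    [IsContinuousRiemannianBundle E (fun x : M ↦ TangentSpace 𝓘(ℝ, E) x)]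
    (hH : IsTonelliHamiltonian H) (x₀ : M) (w₀ : E) :
    ContinuousAt (fun z : M × E ↦ lagrangian H z.1 (ofChart x₀ z.1 z.2)) (x₀, w₀) := by
  have hsrc : ∀ᶠ z : M × E in 𝓝 (x₀, w₀), z.1 ∈ (chartAt E x₀).source :=
    continuousAt_fst.eventually ((chartAt E x₀).open_source.mem_nhds (mem_chart_source E x₀))
  obtain ⟨D, hD, hDx⟩ := eventually_norm_symmL_trivializationAt_lt E
    (fun x : M ↦ TangentSpace 𝓘(ℝ, E) x) x₀
  have hDz : ∀ᶠ z : M × E in 𝓝 (x₀, w₀), ‖ofChart x₀ z.1‖ < D :=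
    continuousAt_fst.eventually (p := fun y : M ↦ ‖ofChart x₀ y‖ < D) hDx
  have hw : ∀ᶠ z : M × E in 𝓝 (x₀, w₀), ‖z.2‖ < ‖w₀‖ + 1 :=
    (continuousAt_snd.norm).eventually_lt continuousAt_const (by simp)
  obtain ⟨C, hC⟩ := hH.superlinear (D * (‖w₀‖ + 1) + 1) (by positivity)
  obtain ⟨A, hA⟩ := hH.bounded 0 le_rfl
  -- For `‖q‖ > R` the slope `1` gained over `D * (‖w₀‖ + 1)` outweighs `C` and `H(·, 0) ≤ A`.
  set R : ℝ := D * max (C + A) 0 with hR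
  set f : M × E → (E →L[ℝ] ℝ) → ℝ := fun z q ↦
    q z.2 - H ⟨z.1, q ∘L toChart x₀ z.1⟩ with hf
  have key : ContinuousAt (fun z ↦ ⨆ q, f z q) (x₀, w₀) := by
    refine continuousAt_iSup_of_compact (K := Metric.closedBall 0 R) (q₀ := 0)
      (isCompact_closedBall 0 R) (by simp [hR]; positivity) (fun q _ ↦ ?_) ?_ ?_
    · refine ContinuousAt.sub (by fun_prop) ?_
      refine (hH.contMDiff.continuous.continuousAt).comp'
        (f := fun z : (M × E) × (E →L[ℝ] ℝ) ↦
          (⟨z.1.1, z.2 ∘L toChart x₀ z.1.1⟩ : CotangentBundle E M)) ?_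
      exact (continuousAt_mk_comp_toChart x₀ q).comp'
        (f := fun z : (M × E) × (E →L[ℝ] ℝ) ↦ (z.1.1, z.2)) (x := ((x₀, w₀), q)) (by fun_prop)
    · filter_upwards [hsrc] with z hz
      obtain ⟨b, hb⟩ := hH.bddAbove z.1 (ofChart x₀ z.1 z.2)
      refine ⟨b, ?_⟩
      rintro _ ⟨q, rfl⟩
      have := hb ⟨q ∘L toChart x₀ z.1, rfl⟩
      simp only [ContinuousLinearMap.comp_apply] at this
      rwa [toChart_ofChart hz] at this
    · filter_upwards [hsrc, hDz, hw] with z hz hzD hzw q hq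
      simp only [hf]
      set p : TangentSpace 𝓘(ℝ, E) z.1 →L[ℝ] ℝ := q ∘L toChart x₀ z.1 with hp
      have hqp : q = p ∘L ofChart x₀ z.1 := by
        ext w
        simp only [hp, ContinuousLinearMap.comp_apply]
        rw [toChart_ofChart hz]
      have h1 : ‖q‖ ≤ ‖p‖ * D := by
        rw [hqp]
        exact (p.opNorm_comp_le _).trans (by gcongr)
      have h2 : q z.2 ≤ ‖p‖ * (D * (‖w₀‖ + 1)) := by
        calc q z.2 ≤ ‖q‖ * ‖z.2‖ := (le_abs_self _).trans (q.le_opNorm _)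
          _ ≤ (‖p‖ * D) * (‖w₀‖ + 1) := by gcongr
          _ = _ := by ring
      have h3 := hC z.1 p
      have h4 : H ⟨z.1, (0 : E →L[ℝ] ℝ) ∘L toChart x₀ z.1⟩ ≤ A := by
        rw [ContinuousLinearMap.zero_comp]
        exact hA z.1 0 ContinuousLinearMap.opNorm_zero.le
      have h5 : R < ‖q‖ := by simpa using hq
      have h6 : max (C + A) 0 < ‖p‖ := by
        by_contra! hcon
        have : ‖p‖ * D ≤ D * max (C + A) 0 := by rw [mul_comm]; gcongr
        linarith
      have h7 := le_max_left (C + A) 0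
      simp only [zero_apply]
      linarith
  refine key.congr_of_eventuallyEq ?_
  filter_upwards [hsrc] with z hz
  exact lagrangian_ofChart H hz z.2

theorem IsTonelliHamiltonian.contDiff_fiber (hH : IsTonelliHamiltonian H) (x : M) :
    ContDiff ℝ 2 (fun p : TangentSpace 𝓘(ℝ, E) x →L[ℝ] ℝ ↦ H ⟨x, p⟩) := by
  rw [← contMDiff_iff_contDiff]
  refine hH.contMDiff.comp (f := fun p : TangentSpace 𝓘(ℝ, E) x →L[ℝ] ℝ ↦
    (⟨x, p⟩ : CotangentBundle E M)) fun p ↦ ?_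
  refine (contMDiffAt_hom_bundle
    (E₁ := fun x : M ↦ TangentSpace 𝓘(ℝ, E) x) (E₂ := fun _ : M ↦ ℝ) _).2
    ⟨contMDiffAt_const, ?_⟩
  refine ContMDiffAt.congr_of_eventuallyEq
    (((ContinuousLinearMap.compL ℝ E (TangentSpace 𝓘(ℝ, E) x) ℝ).flip
      (ofChart x x)).contDiff.contMDiff.contMDiffAt) (Eventually.of_forall fun p ↦ ?_)
  ext w
  simp [ContinuousLinearMap.inCoordinates]

end

/-! ### Fenchel duality and local test functions -/

/-- A `C^2` function with positive second derivative lies above its tangent planes. -/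
theorem add_fderiv_sub_le_of_iteratedFDeriv_two_pos {W : Type*} [NormedAddCommGroup W]
    [NormedSpace ℝ W] {f : W → ℝ} (hf : ContDiff ℝ 2 f)
    (hpos : ∀ p q : W, q ≠ 0 → 0 < iteratedFDeriv ℝ 2 f p ![q, q]) (p q : W) :
    f p + fderiv ℝ f p (q - p) ≤ f q := by
  have hf' : ContDiff ℝ 1 (fderiv ℝ f) := hf.fderiv_right (by norm_num)
  have hline : ∀ t : ℝ, HasDerivAt (fun t : ℝ ↦ p + t • (q - p)) (q - p) t := fun t ↦ by
    simpa using ((hasDerivAt_id t).smul_const (q - p)).const_add p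
  have hg : ∀ t : ℝ, HasDerivAt (fun t : ℝ ↦ f (p + t • (q - p)))
      (fderiv ℝ f (p + t • (q - p)) (q - p)) t := fun t ↦
    ((hf.differentiable (by norm_num)) _).hasFDerivAt.comp_hasDerivAt t (hline t)
  have hg' : ∀ t : ℝ, HasDerivAt (fun t : ℝ ↦ fderiv ℝ f (p + t • (q - p)) (q - p))
      (fderiv ℝ (fderiv ℝ f) (p + t • (q - p)) (q - p) (q - p)) t := fun t ↦ by
    have h := ((hf'.differentiable (by norm_num)) (p + t • (q - p))).hasFDerivAt.comp_hasDerivAt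
      t (hline t)
    simpa using h.clm_apply (hasDerivAt_const t (q - p))
  have hmono : Monotone (fun t : ℝ ↦ fderiv ℝ f (p + t • (q - p)) (q - p)) := by
    refine monotone_of_deriv_nonneg (fun t ↦ (hg' t).differentiableAt) fun t ↦ ?_
    rw [(hg' t).deriv]
    by_cases hqp : q - p = 0
    · simp [hqp]
    · simpa [iteratedFDeriv_two_apply] using (hpos (p + t • (q - p)) (q - p) hqp).le
  obtain ⟨t, ht, hslope⟩ := exists_hasDerivAt_eq_slope (fun t : ℝ ↦ f (p + t • (q - p))) _
    zero_lt_one (fun t _ ↦ (hg t).continuousAt.continuousWithinAt) (fun t _ ↦ hg t)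
  have h := hmono ht.1.le
  simp only [zero_smul, add_zero, one_smul, sub_zero, div_one, add_sub_cancel] at h hslope
  linarith

section
variable {E : Type*} [NormedAddCommGroup E] [NormedSpace ℝ E] [FiniteDimensional ℝ E]
  {M : Type*} [TopologicalSpace M] [ChartedSpace E M] [IsManifold 𝓘(ℝ, E) ∞ M]

/-- Equality is attained in the Fenchel inequality for every covector `p`, at the vector `v` that
represents the fiber derivative of `H` at `p`. -/
theorem IsTonelliHamiltonian.exists_lagrangian_add_le
    [RiemannianBundle (fun x : M ↦ TangentSpace 𝓘(ℝ, E) x)]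
    {H : CotangentBundle E M → ℝ} (hH : IsTonelliHamiltonian H) (x : M)
    (p : TangentSpace 𝓘(ℝ, E) x →L[ℝ] ℝ) :
    ∃ v : TangentSpace 𝓘(ℝ, E) x, lagrangian H x v + H ⟨x, p⟩ ≤ p v := by
  have : FiniteDimensional ℝ (TangentSpace 𝓘(ℝ, E) x) := inferInstanceAs (FiniteDimensional ℝ E)
  set f : (TangentSpace 𝓘(ℝ, E) x →L[ℝ] ℝ) → ℝ := fun p ↦ H ⟨x, p⟩ with hf
  -- The fiber derivative of `H` at `p` is a linear form on covectors, hence a tangent vector.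
  let v : TangentSpace 𝓘(ℝ, E) x := (Module.evalEquiv ℝ (TangentSpace 𝓘(ℝ, E) x)).symm
    ((fderiv ℝ f p : (TangentSpace 𝓘(ℝ, E) x →L[ℝ] ℝ) →ₗ[ℝ] ℝ) ∘ₗ
      (LinearMap.toContinuousLinearMap :
        (TangentSpace 𝓘(ℝ, E) x →ₗ[ℝ] ℝ) ≃ₗ[ℝ] _).toLinearMap)
  have hv : ∀ q : TangentSpace 𝓘(ℝ, E) x →L[ℝ] ℝ, fderiv ℝ f p q = q v := fun q ↦ by
    have h := Module.apply_evalEquiv_symm_apply (R := ℝ) (M := TangentSpace 𝓘(ℝ, E) x)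
      (q : TangentSpace 𝓘(ℝ, E) x →ₗ[ℝ] ℝ)
      ((fderiv ℝ f p : (TangentSpace 𝓘(ℝ, E) x →L[ℝ] ℝ) →ₗ[ℝ] ℝ) ∘ₗ
      (LinearMap.toContinuousLinearMap :
        (TangentSpace 𝓘(ℝ, E) x →ₗ[ℝ] ℝ) ≃ₗ[ℝ] _).toLinearMap)
    exact h.symm
  refine ⟨v, ?_⟩
  have hle : lagrangian H x v ≤ p v - H ⟨x, p⟩ := ciSup_le fun q ↦ by
    have h := add_fderiv_sub_le_of_iteratedFDeriv_two_pos (hH.contDiff_fiber x)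
      (hH.strictConvex x) p q
    have h2 := hv (q - p)
    have h3 : (q - p) v = q v - p v := rfl
    simp only [hf] at h2
    linarith
  linarith

/-- The definition of a viscosity subsolution may be tested with functions that are `C^1` near a
point, at local maxima. -/
theorem IsViscositySubsolutionOn.le_of_isLocalMax [T2Space M] [SecondCountableTopology M]
    {H : CotangentBundle E M → ℝ} {c : ℝ} {U : Set M} {u : M → ℝ}
    (hsub : IsViscositySubsolutionOn H c U u) (hU : IsOpen U) (hu : ContinuousOn u U)
    {φ : M → ℝ} {x₀ : M} (hx₀ : x₀ ∈ U) {V : Set M} (hV : V ∈ 𝓝 x₀)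
    (hφ : ContMDiffOn 𝓘(ℝ, E) 𝓘(ℝ, ℝ) 1 φ V) (hmax : IsLocalMax (fun x ↦ u x - φ x) x₀) :
    H ⟨x₀, mfderiv 𝓘(ℝ, E) 𝓘(ℝ, ℝ) φ x₀⟩ ≤ c := by
  classical
  have : LocallyCompactSpace M := Manifold.locallyCompact_of_finiteDimensional 𝓘(ℝ, E)
  obtain ⟨B, ⟨hB, hBc⟩, hBV⟩ := (closed_nhds_basis x₀).mem_iff.1
    (interior_mem_nhds.2 (inter_mem hV hmax))
  set m : ℝ := u x₀ - φ x₀ with hm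
  have hmax' : ∀ x ∈ interior (V ∩ {x | u x - φ x ≤ u x₀ - φ x₀}), u x - m ≤ φ x := fun x hx ↦ by
    have : u x - φ x ≤ u x₀ - φ x₀ := (interior_subset hx).2
    linarith
  let U' : TopologicalSpace.Opens M := ⟨U, hU⟩
  have : LocallyCompactSpace U' := hU.locallyCompactSpace
  -- The admissible values of the extended test function: those of `φ` near `x₀`, and elsewhere
  -- everything that keeps `u` minus the test function below its value at `x₀`.
  let t : U' → Set ℝ := fun x ↦ if x.1 ∈ B then {φ x.1} else Ici (u x.1 - m)
  have ht : ∀ x, Convex ℝ (t x) := fun x ↦ by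
    by_cases hx : x.1 ∈ B
    · simp only [t, hx, if_true]; exact convex_singleton _
    · simp only [t, hx, if_false]; exact convex_Ici _
  obtain ⟨g, hg⟩ := exists_contMDiffMap_forall_mem_convex_of_local (n := 1) 𝓘(ℝ, E) ht fun x ↦ by
    by_cases hx : x.1 ∈ B
    · refine ⟨_, continuous_subtype_val.continuousAt.preimage_mem_nhds
        (isOpen_interior.mem_nhds (hBV hx)), fun y ↦ φ y.1, ?_, fun y hy ↦ ?_⟩
      · exact hφ.comp contMDiff_subtype_val.contMDiffOn fun y hy ↦ (interior_subset hy).1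
      · by_cases hyB : y.1 ∈ B
        · simp only [t, if_pos hyB, mem_singleton_iff]
        · simp only [t, if_neg hyB, mem_Ici]
          exact hmax' y.1 hy
    · have hcont : ContinuousAt (fun y : U' ↦ u y.1) x :=
        (hu.continuousAt (hU.mem_nhds x.2)).comp' continuousAt_subtype_val
      have hlt : ∀ᶠ y : U' in 𝓝 x, u y.1 < u x.1 + 1 :=
        hcont.eventually_lt continuousAt_const (by simp)
      have hBx : ∀ᶠ y : U' in 𝓝 x, y.1 ∉ B :=
        continuousAt_subtype_val.eventually (hBc.isOpen_compl.mem_nhds hx)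
      refine ⟨_, inter_mem hlt hBx, fun _ ↦ u x.1 + 1 - m, contMDiffOn_const, ?_⟩
      rintro y ⟨hy, hyB⟩
      simp only [t, if_neg hyB]
      have : u y.1 < u x.1 + 1 := hy
      simp only [mem_Ici]
      linarith
  let ψ : M → ℝ := fun x ↦ if h : x ∈ U then g ⟨x, h⟩ else 0
  have hψg : ∀ x : U', ψ x.1 = g x := fun x ↦ dif_pos x.2
  have hψ : ContMDiffOn 𝓘(ℝ, E) 𝓘(ℝ, ℝ) 1 ψ U := fun x hx ↦ by
    refine ContMDiffAt.contMDiffWithinAt ?_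
    refine (contMDiffAt_subtype_iff (U := U') (x := ⟨x, hx⟩)).1 ?_
    simp only [hψg]
    exact g.contMDiff _
  -- Near `x₀` nothing is changed, so that the differential there is that of `φ`.
  have hψB : ∀ x ∈ U, x ∈ B → ψ x = φ x := fun x hxU hxB ↦ by
    have h := hg ⟨x, hxU⟩
    simp only [t, if_pos hxB, mem_singleton_iff] at h
    exact (hψg ⟨x, hxU⟩).trans h
  have hψu : ∀ x ∈ U, u x - ψ x ≤ m := fun x hxU ↦ by
    by_cases hxB : x ∈ B
    · rw [hψB x hxU hxB]
      linarith [hmax' x (hBV hxB)]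
    · have h := hg ⟨x, hxU⟩
      simp only [t, if_neg hxB, mem_Ici] at h
      rw [← hψg] at h
      linarith
  have hψφ : ψ =ᶠ[𝓝 x₀] φ := by
    filter_upwards [hB, hU.mem_nhds hx₀] with x hxB hxU using hψB x hxU hxB
  have := hsub ψ hψ x₀ hx₀ fun x hx ↦ by
    have h := hψu x hx
    rw [hm, ← hψφ.eq_of_nhds] at h
    exact h
  rwa [hψφ.mfderiv_eq] at this

end

/-! ### Subsolutions along curves -/

section

theorem HasDerivWithinAt.nonneg_of_isMaxOn_Icc {k : ℝ → ℝ} {k' a b t : ℝ}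
    (hk : HasDerivWithinAt k k' (Icc a b) t) (ht : t ∈ Ioc a b) (hmax : IsMaxOn k (Icc a b) t) :
    0 ≤ k' := by
  have hcone : a - t ∈ posTangentConeAt (Icc a b) t :=
    sub_mem_posTangentConeAt_of_segment_subset
      ((convex_Icc a b).segment_subset ⟨ht.1.le, ht.2⟩ ⟨le_rfl, ht.1.le.trans ht.2⟩)
  have h := hmax.localize.hasFDerivWithinAt_nonpos hk.hasFDerivWithinAt hcone
  simp only [ContinuousLinearMap.toSpanSingleton_apply, smul_eq_mul] at h
  nlinarith [ht.1]

variable {E : Type*} [NormedAddCommGroup E] [NormedSpace ℝ E] [FiniteDimensional ℝ E]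
  {M : Type*} [TopologicalSpace M] [ChartedSpace E M] [IsManifold 𝓘(ℝ, E) ∞ M]

section
omit [FiniteDimensional ℝ E]

theorem toChart_mfderivWithin {γ : ℝ → M} {S : Set ℝ} {s : ℝ} {x₀ : M}
    (hs : γ s ∈ (chartAt E x₀).source) (hγ : MDifferentiableWithinAt 𝓘(ℝ, ℝ) 𝓘(ℝ, E) γ S s)
    (hS : UniqueDiffWithinAt ℝ S s) :
    toChart x₀ (γ s) (mfderivWithin 𝓘(ℝ, ℝ) 𝓘(ℝ, E) γ S s (1 : ℝ)) =
      derivWithin (fun s ↦ extChartAt 𝓘(ℝ, E) x₀ (γ s)) S s := by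
  have h1 : MDifferentiableAt 𝓘(ℝ, E) 𝓘(ℝ, E) (extChartAt 𝓘(ℝ, E) x₀) (γ s) :=
    mdifferentiableAt_extChartAt hs
  have h2 := (h1.hasMFDerivAt.comp_hasMFDerivWithinAt s hγ.hasMFDerivWithinAt).mfderivWithin
    hS.uniqueMDiffWithinAt
  rw [toChart, TangentBundle.continuousLinearMapAt_trivializationAt hs, ← fderivWithin_derivWithin]
  rw [mfderivWithin_eq_fderivWithin] at h2
  exact (DFunLike.congr_fun h2 (1 : ℝ)).symm

theorem contDiffWithinAt_extChartAt_comp {γ : ℝ → M} {S : Set ℝ} {s : ℝ} {x₀ : M}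
    (hγ : ContMDiffWithinAt 𝓘(ℝ, ℝ) 𝓘(ℝ, E) 1 γ S s) (hs : γ s ∈ (chartAt E x₀).source) :
    ContDiffWithinAt ℝ 1 (fun s ↦ extChartAt 𝓘(ℝ, E) x₀ (γ s)) S s := by
  rw [← contMDiffWithinAt_iff_contDiffWithinAt]
  exact (contMDiffAt_extChartAt' hs).comp_contMDiffWithinAt s hγ

theorem lagrangian_mfderivWithin {H : CotangentBundle E M → ℝ} {γ : ℝ → M} {S : Set ℝ} {s : ℝ}
    {x₀ : M} (hs : γ s ∈ (chartAt E x₀).source)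
    (hγ : MDifferentiableWithinAt 𝓘(ℝ, ℝ) 𝓘(ℝ, E) γ S s) (hS : UniqueDiffWithinAt ℝ S s) :
    lagrangian H (γ s) (mfderivWithin 𝓘(ℝ, ℝ) 𝓘(ℝ, E) γ S s (1 : ℝ)) =
      lagrangian H (γ s)
        (ofChart x₀ (γ s) (derivWithin (fun s ↦ extChartAt 𝓘(ℝ, E) x₀ (γ s)) S s)) := by
  rw [← toChart_mfderivWithin hs hγ hS, ofChart_toChart hs]

theorem continuousWithinAt_derivWithin_extChartAt {γ : ℝ → M} {a b s : ℝ} {x₀ : M} (hab : a < b)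
    (hγ : ContMDiffOn 𝓘(ℝ, ℝ) 𝓘(ℝ, E) 1 γ (Icc a b)) (hs : s ∈ Icc a b)
    (hx : γ s ∈ (chartAt E x₀).source) :
    ContinuousWithinAt (derivWithin (fun s ↦ extChartAt 𝓘(ℝ, E) x₀ (γ s)) (Icc a b))
      (Icc a b) s := by
  have h := ((contDiffWithinAt_extChartAt_comp (hγ s hs) hx).fderivWithin_right (m := 0)
    (uniqueDiffOn_Icc hab) (by norm_num) hs).continuousWithinAt
  exact (h.clm_apply continuousWithinAt_const).congr (fun _ _ ↦ fderivWithin_derivWithin.symm)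
    fderivWithin_derivWithin.symm
end

variable [RiemannianBundle (fun x : M ↦ TangentSpace 𝓘(ℝ, E) x)]
    [IsContinuousRiemannianBundle E (fun x : M ↦ TangentSpace 𝓘(ℝ, E) x)]
  {H : CotangentBundle E M → ℝ}

theorem IsTonelliHamiltonian.continuousOn_lagrangian (hH : IsTonelliHamiltonian H)
    {γ : ℝ → M} {a b : ℝ} (hab : a < b) (hγ : ContMDiffOn 𝓘(ℝ, ℝ) 𝓘(ℝ, E) 1 γ (Icc a b)) :
    ContinuousOn (fun s ↦ lagrangian H (γ s)
      (mfderivWithin 𝓘(ℝ, ℝ) 𝓘(ℝ, E) γ (Icc a b) s (1 : ℝ))) (Icc a b) := by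
  intro s hs
  have hsrc : ∀ᶠ r in 𝓝[Icc a b] s, γ r ∈ (chartAt E (γ s)).source :=
    (hγ s hs).continuousWithinAt.eventually
      ((chartAt E (γ s)).open_source.mem_nhds (mem_chart_source E (γ s)))
  have heq : ∀ r ∈ Icc a b, γ r ∈ (chartAt E (γ s)).source →
      lagrangian H (γ r) (mfderivWithin 𝓘(ℝ, ℝ) 𝓘(ℝ, E) γ (Icc a b) r (1 : ℝ)) = _ :=
    fun r hr hrs ↦ lagrangian_mfderivWithin hrs ((hγ r hr).mdifferentiableWithinAt one_ne_zero)
      (uniqueDiffOn_Icc hab r hr)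
  have hcont : ContinuousWithinAt (fun r ↦ lagrangian H (γ r) (ofChart (γ s) (γ r)
      (derivWithin (fun s' ↦ extChartAt 𝓘(ℝ, E) (γ s) (γ s')) (Icc a b) r))) (Icc a b) s :=
    (hH.continuousAt_lagrangian_ofChart (γ s) _).comp_continuousWithinAt
      (f := fun r ↦ (γ r, derivWithin (fun s' ↦ extChartAt 𝓘(ℝ, E) (γ s) (γ s')) (Icc a b) r))
      ((hγ s hs).continuousWithinAt.prodMk (continuousWithinAt_derivWithin_extChartAt hab hγ hs
        (mem_chart_source E (γ s))))
  refine hcont.congr_of_eventuallyEq ?_ (heq s hs (mem_chart_source E (γ s)))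
  filter_upwards [hsrc, self_mem_nhdsWithin] with r hr hrI using heq r hrI hr

omit [IsContinuousRiemannianBundle E fun x : M ↦ TangentSpace 𝓘(ℝ, E) x] in
/-- The inequality at a maximum point `(x, t)` of the doubled problem, with a general penalty `Q`
of the distance in the chart at `x₀` between `x` and the point with coordinates `η t`. The time
`t` may be the right endpoint, where only a left derivative is available. -/
theorem IsViscositySubsolutionOn.deriv_le_of_isMaxOn_penalized
    [T2Space M] [SecondCountableTopology M]
    {c : ℝ} {U : Set M} {u : M → ℝ} (hsub : IsViscositySubsolutionOn H c U u)
    (hH : IsTonelliHamiltonian H) (hU : IsOpen U) (hu : ContinuousOn u U)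
    {x₀ x : M} (hxU : x ∈ U) (hx : x ∈ (chartAt E x₀).source)
    {η : ℝ → E} {η' : E} {ψ : ℝ → ℝ} {ψ' a b t : ℝ} (ht : t ∈ Ioc a b)
    (hη : HasDerivWithinAt η η' (Icc a b) t) (hψ : HasDerivAt ψ ψ' t)
    {Q : E → ℝ} (hQ : ContDiff ℝ 1 Q)
    (hmaxx : IsLocalMax (fun y ↦ u y - Q (extChartAt 𝓘(ℝ, E) x₀ y - η t)) x)
    (hmaxt : IsMaxOn (fun s ↦ -ψ s - Q (extChartAt 𝓘(ℝ, E) x₀ x - η s)) (Icc a b) t) :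
    ψ' ≤ lagrangian H x (ofChart x₀ x η') + c := by
  set χ := extChartAt 𝓘(ℝ, E) x₀ with hχ
  set q : E →L[ℝ] ℝ := fderiv ℝ Q (χ x - η t) with hq
  have hQd : HasFDerivAt Q q (χ x - η t) := (hQ.differentiable one_ne_zero _).hasFDerivAt
  have hHc : H ⟨x, q ∘L toChart x₀ x⟩ ≤ c := by
    have hQt : ContDiff ℝ 1 (fun z ↦ Q (z - η t)) := by fun_prop
    have hsmooth : ContMDiffOn 𝓘(ℝ, E) 𝓘(ℝ, ℝ) 1 (fun y ↦ Q (χ y - η t))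
        (chartAt E x₀).source :=
      hQt.contMDiff.comp_contMDiffOn (contMDiffOn_extChartAt (n := 1))
    have h := hsub.le_of_isLocalMax hU hu hxU ((chartAt E x₀).open_source.mem_nhds hx) hsmooth hmaxx
    have hQtd : HasFDerivAt (fun z ↦ Q (z - η t)) q (χ x) :=
      HasFDerivAt.comp (χ x) hQd ((hasFDerivAt_id (χ x)).sub_const (η t))
    have hχd : MDifferentiableAt 𝓘(ℝ, E) 𝓘(ℝ, E) χ x := mdifferentiableAt_extChartAt hx
    have hder := (hQtd.hasMFDerivAt.comp x hχd.hasMFDerivAt).mfderiv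
    rw [toChart, TangentBundle.continuousLinearMapAt_trivializationAt hx]
    have hder' : mfderiv 𝓘(ℝ, E) 𝓘(ℝ, ℝ) (fun y ↦ Q (χ y - η t)) x =
      q ∘L mfderiv 𝓘(ℝ, E) 𝓘(ℝ, E) χ x := hder
    rw [hder'] at h
    exact h
  have hψq : ψ' ≤ q η' := by
    have h1 : HasDerivWithinAt (fun s ↦ -ψ s - Q (χ x - η s)) (-ψ' - q (-η')) (Icc a b) t :=
      hψ.hasDerivWithinAt.neg.sub (hQd.comp_hasDerivWithinAt t (hη.const_sub (χ x)))
    have h2 := h1.nonneg_of_isMaxOn_Icc ht hmaxt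
    rw [map_neg] at h2
    linarith
  have hF := hH.le_lagrangian_add x (q ∘L toChart x₀ x) (ofChart x₀ x η')
  rw [ContinuousLinearMap.comp_apply, toChart_ofChart hx] at hF
  linarith

/-- A viscosity subsolution `u`, restricted to a `C^1` curve `γ`, is a viscosity subsolution of
`w' = L(γ, γ') + c`, also at the right endpoint `t₀` of the curve. The proof doubles the
variables and penalizes the distance in the chart at `γ t₀`. -/
theorem IsViscositySubsolutionOn.deriv_le_lagrangian [T2Space M] [SecondCountableTopology M]
    {c : ℝ} {U : Set M} {u : M → ℝ} (hsub : IsViscositySubsolutionOn H c U u)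
    (hH : IsTonelliHamiltonian H) (hU : IsOpen U) (hu : ContinuousOn u U)
    {γ : ℝ → M} {t₁ t₀ : ℝ} (ht : t₁ < t₀) (hγ : ContMDiffOn 𝓘(ℝ, ℝ) 𝓘(ℝ, E) 1 γ (Icc t₁ t₀))
    (hγU : γ t₀ ∈ U) (hγs : ∀ t ∈ Icc t₁ t₀, γ t ∈ (chartAt E (γ t₀)).source)
    {ψ ψ' : ℝ → ℝ} (hψ : ∀ t, HasDerivAt ψ (ψ' t) t) (hψ' : Continuous ψ')
    (hmax : ∀ t ∈ Icc t₁ t₀, t ≠ t₀ → u (γ t) - ψ t < u (γ t₀) - ψ t₀) :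
    ψ' t₀ ≤ lagrangian H (γ t₀)
      (mfderivWithin 𝓘(ℝ, ℝ) 𝓘(ℝ, E) γ (Icc t₁ t₀) t₀ (1 : ℝ)) + c := by
  have : LocallyCompactSpace M := Manifold.locallyCompact_of_finiteDimensional 𝓘(ℝ, E)
  set x₀ := γ t₀ with hx₀
  set χ := extChartAt 𝓘(ℝ, E) x₀ with hχ
  set η : ℝ → E := fun t ↦ χ (γ t) with hη
  set J := Icc t₁ t₀ with hJ
  set η' : ℝ → E := derivWithin η J with hη'
  have hsrc : χ.source = (chartAt E x₀).source := extChartAt_source _ _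
  have ht₀ : t₀ ∈ J := ⟨ht.le, le_rfl⟩
  have hηc : ContinuousOn η J := fun t htJ ↦
    (contDiffWithinAt_extChartAt_comp (hγ t htJ) (hγs t htJ)).continuousWithinAt
  obtain ⟨B, hBc, hBx, hBs⟩ := exists_compact_subset (hU.inter (chartAt E x₀).open_source)
    ⟨hγU, mem_chart_source E x₀⟩
  have hxB : x₀ ∈ B := interior_subset hBx
  -- `E` carries an arbitrary norm; `toEuclidean` makes the squared distance differentiable.
  let Q : ℕ → E → ℝ := fun n z ↦ n * ‖toEuclidean z‖ ^ 2
  have hQ : ∀ n, ContDiff ℝ 1 (Q n) := fun n ↦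
    contDiff_const.mul ((toEuclidean (E := E)).contDiff.norm_sq ℝ)
  let G : M × ℝ → ℝ := fun z ↦ u z.1 - ψ z.2
  let F : ℕ → M × ℝ → ℝ := fun n z ↦ G z - Q n (χ z.1 - η z.2)
  have hψc : Continuous ψ := continuous_iff_continuousAt.2 fun t ↦ (hψ t).continuousAt
  have hG : ContinuousOn G (B ×ˢ J) :=
    ((hu.mono fun x hx ↦ (hBs hx).1).comp continuousOn_fst fun z hz ↦ hz.1).sub
      (hψc.comp continuous_snd).continuousOn
  have hdiff : ContinuousOn (fun z : M × ℝ ↦ χ z.1 - η z.2) (B ×ˢ J) :=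
    (((continuousOn_extChartAt x₀).mono fun x hx ↦ by rw [hsrc]; exact (hBs hx).2).comp
      continuousOn_fst fun z hz ↦ hz.1).sub (hηc.comp continuousOn_snd fun z hz ↦ hz.2)
  have hF : ∀ n, ContinuousOn (F n) (B ×ˢ J) := fun n ↦
    hG.sub ((hQ n).continuous.comp_continuousOn hdiff)
  have hcomp : IsCompact (B ×ˢ J) := hBc.prod isCompact_Icc
  have hz₀ : (x₀, t₀) ∈ B ×ˢ J := ⟨hxB, ht₀⟩
  choose z hzB hzmax using fun n ↦ hcomp.exists_isMaxOn ⟨_, hz₀⟩ (hF n)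
  have hzm : ∀ n, G (x₀, t₀) ≤ F n (z n) := fun n ↦ by
    have h : F n (x₀, t₀) ≤ F n (z n) := hzmax n hz₀
    have h0 : F n (x₀, t₀) = G (x₀, t₀) := by simp [F, Q, hη, ← hx₀]
    rwa [h0] at h
  obtain ⟨z', hz', θ, hθ, hlim⟩ := hcomp.tendsto_subseq hzB
  have hlimW : Tendsto (z ∘ θ) atTop (𝓝[B ×ˢ J] z') :=
    tendsto_nhdsWithin_iff.2 ⟨hlim, Eventually.of_forall fun n ↦ hzB _⟩
  -- The values `F n (z n)` are at least the value at `(x₀, t₀)`, where there is no penalty. Hence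
  -- the penalty vanishes at the limit `z'`, and strict maximality forces `z' = (x₀, t₀)`.
  have hGz' : G (x₀, t₀) ≤ G z' := by
    refine ge_of_tendsto ((hG z' hz').tendsto.comp hlimW) (Eventually.of_forall fun n ↦ ?_)
    have h := hzm (θ n)
    have h0 : 0 ≤ Q (θ n) (χ (z (θ n)).1 - η (z (θ n)).2) := by positivity
    simp only [F] at h
    simp only [Function.comp_apply]
    linarith
  have hχz' : χ z'.1 = η z'.2 := by
    obtain ⟨A, hA⟩ := hcomp.bddAbove_image hG
    have h1 : Tendsto (fun n ↦ ‖toEuclidean (χ (z (θ n)).1 - η (z (θ n)).2)‖ ^ 2) atTop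
        (𝓝 (‖toEuclidean (χ z'.1 - η z'.2)‖ ^ 2)) :=
      ((((toEuclidean (E := E)).continuous.comp_continuousOn hdiff) z' hz').tendsto.comp
        hlimW).norm.pow 2
    have h2 : Tendsto (fun n ↦ (A - G (x₀, t₀)) / (θ n : ℝ)) atTop (𝓝 0) :=
      tendsto_const_nhds.div_atTop (tendsto_natCast_atTop_atTop.comp hθ.tendsto_atTop)
    have h3 : ‖toEuclidean (χ z'.1 - η z'.2)‖ ^ 2 ≤ 0 := by
      refine le_of_tendsto_of_tendsto h1 h2 ?_
      filter_upwards [eventually_gt_atTop 0] with n hn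
      have hpos : (0 : ℝ) < θ n := by exact_mod_cast hn.trans_le (hθ.id_le n)
      rw [le_div_iff₀ hpos]
      have h4 := hzm (θ n)
      have h5 : G (z (θ n)) ≤ A := hA ⟨_, hzB _, rfl⟩
      simp only [F, Q] at h4
      linarith
    have h4 : ‖toEuclidean (χ z'.1 - η z'.2)‖ = 0 := by
      have := sq_nonneg ‖toEuclidean (χ z'.1 - η z'.2)‖
      exact pow_eq_zero_iff (two_ne_zero) |>.1 (le_antisymm h3 this)
    simpa [sub_eq_zero] using h4
  have hz'x : z'.1 = γ z'.2 :=
    χ.injOn (by rw [hsrc]; exact (hBs hz'.1).2) (by rw [hsrc]; exact hγs _ hz'.2) hχz'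
  have hz't : z'.2 = t₀ := by
    by_contra hne
    have h := hmax _ hz'.2 hne
    simp only [G, hz'x] at hGz'
    linarith
  have hz'eq : z' = (x₀, t₀) := Prod.ext (by rw [hz'x, hz't]) hz't
  rw [hz'eq] at hlim
  have key : ∀ n, (z n).1 ∈ interior B → t₁ < (z n).2 →
      ψ' (z n).2 ≤ lagrangian H (z n).1 (ofChart x₀ (z n).1 (η' (z n).2)) + c := by
    intro n hxn htn
    have htJ : (z n).2 ∈ J := (hzB n).2
    have hη'n : HasDerivWithinAt η (η' (z n).2) J (z n).2 :=
      ((contDiffWithinAt_extChartAt_comp (hγ _ htJ) (hγs _ htJ)).differentiableWithinAt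
        one_ne_zero).hasDerivWithinAt
    refine hsub.deriv_le_of_isMaxOn_penalized hH hU hu (hBs (hzB n).1).1 (hBs (hzB n).1).2
      ⟨htn, htJ.2⟩ hη'n (hψ _) (hQ n) ?_ ?_
    · filter_upwards [mem_interior_iff_mem_nhds.1 hxn] with y hy
      have h : F n (y, (z n).2) ≤ F n (z n) := hzmax n ⟨hy, htJ⟩
      simp only [F, G] at h
      linarith
    · intro s hs
      have h : F n ((z n).1, s) ≤ F n (z n) := hzmax n ⟨(hzB n).1, hs⟩
      simp only [F, G] at h
      simp only [mem_ofPred_eq]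
      linarith
  have hlimx : Tendsto (fun n ↦ (z (θ n)).1) atTop (𝓝 x₀) := hlim.fst_nhds
  have hlimt : Tendsto (fun n ↦ (z (θ n)).2) atTop (𝓝 t₀) := hlim.snd_nhds
  have hηlim : Tendsto (fun n ↦ η' (z (θ n)).2) atTop (𝓝 (η' t₀)) :=
    (continuousWithinAt_derivWithin_extChartAt ht hγ ht₀ (hγs t₀ ht₀)).tendsto.comp
      (tendsto_nhdsWithin_iff.2 ⟨hlimt, Eventually.of_forall fun n ↦ (hzB _).2⟩)
  have hLlim : Tendsto (fun n ↦ lagrangian H (z (θ n)).1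
      (ofChart x₀ (z (θ n)).1 (η' (z (θ n)).2)) + c) atTop
      (𝓝 (lagrangian H x₀ (ofChart x₀ x₀ (η' t₀)) + c)) :=
    ((hH.continuousAt_lagrangian_ofChart x₀ (η' t₀)).tendsto.comp
      (hlimx.prodMk_nhds hηlim)).add_const c
  have hfinal := le_of_tendsto_of_tendsto ((hψ'.tendsto t₀).comp hlimt) hLlim (by
    filter_upwards [hlimx.eventually (isOpen_interior.mem_nhds hBx),
      hlimt.eventually (Ioi_mem_nhds ht)] with n hn1 hn2 using key _ hn1 hn2)
  rwa [lagrangian_mfderivWithin (x₀ := x₀) (hγs t₀ ht₀)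
    ((hγ t₀ ht₀).mdifferentiableWithinAt one_ne_zero) (uniqueDiffOn_Icc ht t₀ ht₀)]

end

/-! ### Domination -/

section

variable {E : Type*} [NormedAddCommGroup E] [NormedSpace ℝ E]
  {M : Type*} [TopologicalSpace M] [ChartedSpace E M]

theorem lagrangian_velocity_eqOn (H : CotangentBundle E M → ℝ) (γ : ℝ → M) (a b : ℝ) :
    EqOn (fun s ↦ lagrangian H (γ s) (velocity (E := E) γ s))
      (fun s ↦ lagrangian H (γ s) (mfderivWithin 𝓘(ℝ, ℝ) 𝓘(ℝ, E) γ (Icc a b) s (1 : ℝ)))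
      (Ioo a b) := fun s hs ↦ by
  simp only [velocity, mfderivWithin_of_mem_nhds (Icc_mem_nhds hs.1 hs.2)]

section
variable [IsManifold 𝓘(ℝ, E) ∞ M]

theorem tangentBundle_mk_eq_of_toChart_eq {x y : M} {v : TangentSpace 𝓘(ℝ, E) x}
    {w : TangentSpace 𝓘(ℝ, E) y} (hyx : y = x) (h : toChart x y w = toChart x x v) :
    (⟨y, w⟩ : TangentBundle 𝓘(ℝ, E) M) = ⟨x, v⟩ := by
  subst hyx
  rw [← ofChart_toChart (mem_chart_source E y) w, h, ofChart_toChart (mem_chart_source E y) v]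

/-- Every tangent vector is the final velocity of a `C^1` curve, a segment in a chart. The equality
is stated in the tangent bundle since `γ 0 = x₀` holds only propositionally. -/
theorem exists_curve_ending_at {U : Set M} {x₀ : M} (hU : U ∈ 𝓝 x₀)
    (v : TangentSpace 𝓘(ℝ, E) x₀) :
    ∃ (γ : ℝ → M) (a : ℝ), a < 0 ∧ ContMDiffOn 𝓘(ℝ, ℝ) 𝓘(ℝ, E) 1 γ (Icc a 0) ∧
      (∀ s ∈ Icc a 0, γ s ∈ U) ∧
      (⟨γ 0, mfderivWithin 𝓘(ℝ, ℝ) 𝓘(ℝ, E) γ (Icc a 0) 0 (1 : ℝ)⟩ : TangentBundle 𝓘(ℝ, E) M) =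
        ⟨x₀, v⟩ := by
  set χ := extChartAt 𝓘(ℝ, E) x₀ with hχ
  set w : E := toChart x₀ x₀ v with hw
  let l : ℝ → E := fun s ↦ χ x₀ + s • w
  have hl0 : l 0 = χ x₀ := by simp [l]
  have hlc : ContDiff ℝ 1 l := by fun_prop
  have hnear : ∀ᶠ y in 𝓝 (χ x₀), y ∈ χ.target ∧ χ.symm y ∈ U :=
    inter_mem (extChartAt_target_mem_nhds x₀) ((continuousAt_extChartAt_symm x₀).preimage_mem_nhds
      (by simpa using hU))
  have hnear' : ∀ᶠ s in 𝓝 (0 : ℝ), l s ∈ χ.target ∧ χ.symm (l s) ∈ U :=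
    hlc.continuous.continuousAt.eventually (by rwa [hl0])
  obtain ⟨ε, hε, hball⟩ := Metric.eventually_nhds_iff.1 hnear'
  have hIcc : ∀ s ∈ Icc (-(ε / 2)) 0, l s ∈ χ.target ∧ χ.symm (l s) ∈ U := fun s hs ↦
    hball (by rw [Real.dist_eq, sub_zero, abs_lt]; constructor <;> linarith [hs.1, hs.2])
  have ha : -(ε / 2) < 0 := by linarith
  have h0 : (0 : ℝ) ∈ Icc (-(ε / 2)) 0 := ⟨ha.le, le_rfl⟩
  have hγ0 : χ.symm (l 0) = x₀ := by rw [hl0, hχ, extChartAt_to_inv]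
  have hγ : ContMDiffOn 𝓘(ℝ, ℝ) 𝓘(ℝ, E) 1 (fun s ↦ χ.symm (l s)) (Icc (-(ε / 2)) 0) :=
    (contMDiffOn_extChartAt_symm (n := 1) x₀).comp hlc.contMDiff.contMDiffOn
      fun s hs ↦ (hIcc s hs).1
  refine ⟨fun s ↦ χ.symm (l s), -(ε / 2), ha, hγ, fun s hs ↦ (hIcc s hs).2,
    tangentBundle_mk_eq_of_toChart_eq hγ0 ?_⟩
  rw [toChart_mfderivWithin (by rw [hγ0]; exact mem_chart_source E x₀)
    ((hγ 0 h0).mdifferentiableWithinAt one_ne_zero) (uniqueDiffOn_Icc ha 0 h0)]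
  have hld : HasDerivAt l w 0 := by
    have h := ((hasDerivAt_id (0 : ℝ)).smul_const w).const_add (χ x₀)
    rwa [one_smul] at h
  refine HasDerivWithinAt.derivWithin ?_ (uniqueDiffOn_Icc ha 0 h0)
  exact hld.hasDerivWithinAt.congr_of_mem (fun s hs ↦ χ.right_inv (hIcc s hs).1) h0

variable [FiniteDimensional ℝ E]
  [RiemannianBundle (fun x : M ↦ TangentSpace 𝓘(ℝ, E) x)]
  [IsContinuousRiemannianBundle E (fun x : M ↦ TangentSpace 𝓘(ℝ, E) x)]
  {H : CotangentBundle E M → ℝ} {c : ℝ} {U : Set M} {u : M → ℝ}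

theorem IsTonelliHamiltonian.intervalIntegrable_lagrangian (hH : IsTonelliHamiltonian H)
    {γ : ℝ → M} {a b : ℝ} (hab : a < b) (hγ : ContMDiffOn 𝓘(ℝ, ℝ) 𝓘(ℝ, E) 1 γ (Icc a b)) :
    IntervalIntegrable (fun s ↦ lagrangian H (γ s) (velocity (E := E) γ s)) volume a b := by
  refine IntervalIntegrable.congr_uIoo
    ((hH.continuousOn_lagrangian hab hγ).intervalIntegrable_of_Icc hab.le) ?_
  rw [uIoo_of_le hab.le]
  exact (lagrangian_velocity_eqOn H γ a b).symm

/-- The function `t ↦ L(γ t, γ' t)`, with one-sided velocities at the endpoints, has a continuous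
extension to the line, with the same integrals over subintervals of `[a, b]`. -/
theorem IsTonelliHamiltonian.exists_continuous_eqOn_lagrangian (hH : IsTonelliHamiltonian H)
    {γ : ℝ → M} {a b : ℝ} (hab : a < b) (hγ : ContMDiffOn 𝓘(ℝ, ℝ) 𝓘(ℝ, E) 1 γ (Icc a b)) :
    ∃ g : ℝ → ℝ, Continuous g ∧
      (∀ t ∈ Icc a b,
        g t = lagrangian H (γ t) (mfderivWithin 𝓘(ℝ, ℝ) 𝓘(ℝ, E) γ (Icc a b) t (1 : ℝ))) ∧
      ∀ t ∈ Icc a b, ∀ t' ∈ Icc a b, t ≤ t' →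
        ∫ s in t..t', lagrangian H (γ s) (velocity (E := E) γ s) = ∫ s in t..t', g s := by
  refine ⟨IccExtend hab.le ((Icc a b).domRestrict fun s ↦ lagrangian H (γ s)
      (mfderivWithin 𝓘(ℝ, ℝ) 𝓘(ℝ, E) γ (Icc a b) s (1 : ℝ))),
    (hH.continuousOn_lagrangian hab hγ).domRestrict.Icc_extend', fun t ht ↦ ?_,
    fun t ht t' ht' htt' ↦ ?_⟩
  · rw [IccExtend_of_mem _ _ ht]
    rfl
  · refine intervalIntegral.integral_congr_Ioo_of_le htt' fun s hs ↦ ?_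
    have hs' : s ∈ Ioo a b := ⟨ht.1.trans_lt hs.1, hs.2.trans_le ht'.2⟩
    rw [IccExtend_of_mem _ _ (Ioo_subset_Icc_self hs')]
    exact lagrangian_velocity_eqOn H γ a b hs'

/-- A viscosity subsolution satisfies the domination inequality along a `C^1` curve. -/
theorem IsViscositySubsolutionOn.sub_le_integral [T2Space M] [SecondCountableTopology M]
    (hsub : IsViscositySubsolutionOn H c U u)
    (hH : IsTonelliHamiltonian H) (hU : IsOpen U) (hu : ContinuousOn u U)
    {γ : ℝ → M} {a b : ℝ} (hab : a < b) (hγ : ContMDiffOn 𝓘(ℝ, ℝ) 𝓘(ℝ, E) 1 γ (Icc a b))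
    (hγU : ∀ s ∈ Icc a b, γ s ∈ U) :
    u (γ b) - u (γ a) ≤
      (∫ s in a..b, lagrangian H (γ s) (velocity (E := E) γ s)) + c * (b - a) := by
  obtain ⟨g, hgc, hg, hgint⟩ := hH.exists_continuous_eqOn_lagrangian hab hγ
  have haI : a ∈ Icc a b := ⟨le_rfl, hab.le⟩
  have hbI : b ∈ Icc a b := ⟨hab.le, le_rfl⟩
  rw [hgint a haI b hbI hab.le]
  by_contra! hcon
  set d : ℝ := u (γ b) - u (γ a) - ((∫ s in a..b, g s) + c * (b - a)) with hd
  have hdpos : 0 < d := by linarith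
  have hba : 0 < b - a := sub_pos.2 hab
  -- The slope `δ` is small enough to keep the value of `u ∘ γ - ψ` at `b` above that at `a`.
  obtain ⟨δ, hδ, hδd⟩ : ∃ δ > 0, δ * (b - a) < d :=
    ⟨d / (2 * (b - a)), by positivity, by field_simp; linarith⟩
  let ψ : ℝ → ℝ := fun t ↦ (∫ s in a..t, g s) + (c + δ) * (t - a)
  have hψ : ∀ t, HasDerivAt ψ (g t + (c + δ)) t := fun t ↦ by
    have h := (hgc.integral_hasStrictDerivAt a t).hasDerivAt.add
      (((hasDerivAt_id t).sub_const a).const_mul (c + δ))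
    rwa [mul_one] at h
  have hψc : Continuous ψ := continuous_iff_continuousAt.2 fun t ↦ (hψ t).continuousAt
  obtain ⟨t₀, ht₀, hmax⟩ := isCompact_Icc.exists_isMaxOn (nonempty_Icc.2 hab.le)
    ((hu.comp hγ.continuousOn hγU).sub hψc.continuousOn)
  have hmax' : ∀ t ∈ Icc a b, u (γ t) - ψ t ≤ u (γ t₀) - ψ t₀ := fun t ht ↦ hmax ht
  have hat₀ : a < t₀ := by
    refine lt_of_le_of_ne ht₀.1 fun heq ↦ ?_
    have h := hmax' b hbI
    rw [← heq] at h
    simp only [ψ, intervalIntegral.integral_same, sub_self, mul_zero, add_zero] at h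
    linarith [add_mul c δ (b - a)]
  have hsrc : ∀ᶠ t in 𝓝[Icc a b] t₀, γ t ∈ (chartAt E (γ t₀)).source :=
    (hγ t₀ ht₀).continuousWithinAt.eventually
      ((chartAt E (γ t₀)).open_source.mem_nhds (mem_chart_source E (γ t₀)))
  obtain ⟨ε, hε, hball⟩ := Metric.mem_nhdsWithin_iff.1 hsrc
  obtain ⟨t₁, ht₁a, ht₁⟩ := exists_between (max_lt hat₀ (sub_lt_self t₀ hε))
  have hat₁ : a < t₁ := (le_max_left _ _).trans_lt ht₁a
  have hεt₁ : t₀ - ε < t₁ := (le_max_right _ _).trans_lt ht₁a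
  have hsubset : Icc t₁ t₀ ⊆ Icc a b := Icc_subset_Icc hat₁.le ht₀.2
  -- Adding `(t - t₀) ^ 2` makes the maximum strict and leaves the derivative at `t₀` unchanged.
  have hsq : ∀ t, HasDerivAt (fun t ↦ (t - t₀) ^ 2) (2 * (t - t₀)) t := fun t ↦
    (((hasDerivAt_id t).sub_const t₀).pow 2).congr_deriv (by simp)
  have key := hsub.deriv_le_lagrangian hH hU hu ht₁ (hγ.mono hsubset) (hγU t₀ ht₀)
    (fun t ht ↦ hball ⟨by
      rw [Metric.mem_ball, Real.dist_eq, abs_lt]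
      constructor <;> linarith [ht.1, ht.2], hsubset ht⟩)
    (ψ := fun t ↦ ψ t + (t - t₀) ^ 2) (ψ' := fun t ↦ g t + (c + δ) + 2 * (t - t₀))
    (fun t ↦ (hψ t).add (hsq t))
    (by fun_prop) (fun t ht hne ↦ by
      have h1 := hmax' t (hsubset ht)
      have h2 : 0 < (t - t₀) ^ 2 := by
        have := sub_ne_zero.2 hne
        positivity
      simp only [sub_self]
      linarith)
  have ht₀J : t₀ ∈ Icc t₁ t₀ := ⟨ht₁.le, le_rfl⟩
  rw [mfderivWithin_subset hsubset (uniqueDiffOn_Icc ht₁ t₀ ht₀J).uniqueMDiffWithinAt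
    ((hγ t₀ ht₀).mdifferentiableWithinAt one_ne_zero), ← hg t₀ ht₀] at key
  simp only [sub_self, mul_zero, add_zero] at key
  linarith

theorem IsViscositySubsolutionOn.isDominatedOn [T2Space M] [SecondCountableTopology M]
    (hsub : IsViscositySubsolutionOn H c U u)
    (hH : IsTonelliHamiltonian H) (hU : IsOpen U) (hu : ContinuousOn u U) :
    IsDominatedOn H c U u := by
  rintro γ a b - ⟨n, t, rfl, rfl, ht⟩ hγU
  have hmono : ∀ i j, i ≤ j → j ≤ n → t i ≤ t j := fun i j hij ↦ by
    induction j, hij using Nat.le_induction with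
    | base => exact fun _ ↦ le_rfl
    | succ j hij ih => exact fun hj ↦ (ih (by omega)).trans (ht j (by omega)).1.le
  rw [← intervalIntegral.sum_integral_adjacent_intervals fun i hi ↦
      hH.intervalIntegrable_lagrangian (ht i hi).1 (ht i hi).2,
    ← Finset.sum_range_sub t n, ← Finset.sum_range_sub (fun i ↦ u (γ (t i))) n, Finset.mul_sum,
    ← Finset.sum_add_distrib]
  refine Finset.sum_le_sum fun i hi ↦ ?_
  have hin := Finset.mem_range.1 hi
  exact hsub.sub_le_integral hH hU hu (ht i hin).1 (ht i hin).2 fun s hs ↦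
    hγU s ⟨(hmono 0 i (by omega) (by omega)).trans hs.1, hs.2.trans (hmono (i + 1) n hin le_rfl)⟩

/-- At a maximum point of `u - φ` reached by a curve in `U`, the differential of `φ` at the final
velocity of the curve is at most `L + c`: the function `t ↦ ∫_a^t L + c t - φ (γ t)` is maximal at
the right endpoint. -/
theorem IsDominatedOn.mfderiv_le_lagrangian (hdom : IsDominatedOn H c U u)
    (hH : IsTonelliHamiltonian H) {φ : M → ℝ} {γ : ℝ → M} {a b : ℝ} (hab : a < b)
    (hγ : ContMDiffOn 𝓘(ℝ, ℝ) 𝓘(ℝ, E) 1 γ (Icc a b)) (hγU : ∀ s ∈ Icc a b, γ s ∈ U)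
    {p : TangentSpace 𝓘(ℝ, E) (γ b) →L[ℝ] ℝ} (hφ : HasMFDerivAt 𝓘(ℝ, E) 𝓘(ℝ, ℝ) φ (γ b) p)
    (hmax : IsMaxOn (fun x ↦ u x - φ x) U (γ b)) :
    p (mfderivWithin 𝓘(ℝ, ℝ) 𝓘(ℝ, E) γ (Icc a b) b (1 : ℝ)) ≤
      lagrangian H (γ b) (mfderivWithin 𝓘(ℝ, ℝ) 𝓘(ℝ, E) γ (Icc a b) b (1 : ℝ)) + c := by
  obtain ⟨g, hgc, hg, hgint⟩ := hH.exists_continuous_eqOn_lagrangian hab hγ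
  have hbI : b ∈ Icc a b := ⟨hab.le, le_rfl⟩
  let k : ℝ → ℝ := fun t ↦ (∫ s in a..t, g s) + c * t - φ (γ t)
  have hder : HasDerivWithinAt k (g b + c - p
      (mfderivWithin 𝓘(ℝ, ℝ) 𝓘(ℝ, E) γ (Icc a b) b (1 : ℝ))) (Icc a b) b := by
    refine HasDerivWithinAt.sub ?_ ?_
    · have h := (hgc.integral_hasStrictDerivAt a b).hasDerivAt.add
        ((hasDerivAt_id b).const_mul c)
      rw [mul_one] at h
      exact h.hasDerivWithinAt
    · have h := hφ.comp_hasMFDerivWithinAt b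
        ((hγ b hbI).mdifferentiableWithinAt one_ne_zero).hasMFDerivWithinAt
      let D : ℝ →L[ℝ] ℝ := p ∘L mfderivWithin 𝓘(ℝ, ℝ) 𝓘(ℝ, E) γ (Icc a b) b
      have hD : HasFDerivWithinAt (fun t ↦ φ (γ t)) D (Icc a b) b := h.hasFDerivWithinAt
      exact hD.hasDerivWithinAt
  have hkmax : IsMaxOn k (Icc a b) b := fun t ht ↦ by
    simp only [mem_ofPred_eq, k]
    have h1 := hmax (hγU t ht)
    simp only [mem_ofPred_eq] at h1
    rcases ht.2.eq_or_lt with rfl | htb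
    · exact le_rfl
    have hsubset : Icc t b ⊆ Icc a b := Icc_subset_Icc_left ht.1
    have h2 := hdom γ t b ht.2 ⟨1, fun i ↦ if i = 0 then t else b, rfl, rfl, fun i hi ↦ by
      obtain rfl : i = 0 := by omega
      exact ⟨htb, hγ.mono hsubset⟩⟩ fun s hs ↦ hγU s (hsubset hs)
    rw [hgint t ht b hbI ht.2, ← intervalIntegral.integral_interval_sub_left
      (hgc.intervalIntegrable a b) (hgc.intervalIntegrable a t)] at h2
    linarith
  have h := hder.nonneg_of_isMaxOn_Icc ⟨hab, le_rfl⟩ hkmax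
  rw [hg b hbI] at h
  linarith

theorem IsDominatedOn.isViscositySubsolutionOn (hdom : IsDominatedOn H c U u)
    (hH : IsTonelliHamiltonian H) (hU : IsOpen U) : IsViscositySubsolutionOn H c U u := by
  intro φ hφ x₀ hx₀ hmax
  set p : TangentSpace 𝓘(ℝ, E) x₀ →L[ℝ] ℝ := mfderiv 𝓘(ℝ, E) 𝓘(ℝ, ℝ) φ x₀ with hp
  have hφp : HasMFDerivAt 𝓘(ℝ, E) 𝓘(ℝ, ℝ) φ x₀ p :=
    ((hφ.contMDiffAt (hU.mem_nhds hx₀)).mdifferentiableAt one_ne_zero).hasMFDerivAt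
  obtain ⟨v, hv⟩ := hH.exists_lagrangian_add_le x₀ p
  obtain ⟨γ, a, ha, hγ, hγU, hγv⟩ := exists_curve_ending_at (hU.mem_nhds hx₀) v
  have hγ0 : γ 0 = x₀ := congrArg TotalSpace.proj hγv
  -- The inequality is transported along an equality of tangent vectors at different base points.
  let P : TangentBundle 𝓘(ℝ, E) M → Prop := fun z ↦
    ∀ p : TangentSpace 𝓘(ℝ, E) z.1 →L[ℝ] ℝ, HasMFDerivAt 𝓘(ℝ, E) 𝓘(ℝ, ℝ) φ z.1 p →
      p z.2 ≤ lagrangian H z.1 z.2 + c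
  have key : P ⟨γ 0, mfderivWithin 𝓘(ℝ, ℝ) 𝓘(ℝ, E) γ (Icc a 0) 0 (1 : ℝ)⟩ := fun p hp ↦
    hdom.mfderiv_le_lagrangian hH ha hγ hγU hp (by rwa [hγ0])
  rw [hγv] at key
  have hle : p v ≤ lagrangian H x₀ v + c := key p hφp
  linarith

end
end

theorem mainTheorem11
    {E : Type*} [NormedAddCommGroup E] [NormedSpace ℝ E] [FiniteDimensional ℝ E]
    {M : Type*} [MetricSpace M] [ConnectedSpace M] [CompleteSpace M]
    [ChartedSpace E M] [IsManifold 𝓘(ℝ, E) ∞ M]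
    [RiemannianBundle (fun x : M ↦ TangentSpace 𝓘(ℝ, E) x)]
    [IsContMDiffRiemannianBundle 𝓘(ℝ, E) ∞ E (fun x : M ↦ TangentSpace 𝓘(ℝ, E) x)]
    [IsRiemannianManifold 𝓘(ℝ, E) M]
    (H : CotangentBundle E M → ℝ) (hH : IsTonelliHamiltonian H) (c : ℝ)
    (U : Set M) (hU : IsOpen U) (u : M → ℝ) (hu : ContinuousOn u U) :
    IsViscositySubsolutionOn H c U u ↔ IsDominatedOn H c U u := by
  have : LocallyCompactSpace M := Manifold.locallyCompact_of_finiteDimensional 𝓘(ℝ, E)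
  have : SigmaCompactSpace M := sigmaCompactSpace_of_connected_paracompact M
  have : SecondCountableTopology M := ChartedSpace.secondCountable_of_sigmaCompact E M
  have : IsContinuousRiemannianBundle E (fun x : M ↦ TangentSpace 𝓘(ℝ, E) x) :=
    let ⟨g, hg, hinner⟩ := IsContMDiffRiemannianBundle.exists_contMDiff (IB := 𝓘(ℝ, E)) (n := ∞)
      (F := E) (E := fun x : M ↦ TangentSpace 𝓘(ℝ, E) x)
    ⟨⟨g, hg.continuous, hinner⟩⟩
  exact ⟨fun h ↦ h.isDominatedOn hH hU hu, fun h ↦ h.isViscositySubsolutionOn hH hU⟩
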